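/- Let $R$ be an integral domain with fraction field $K$. A nonzero ideal $I$ of $R$ is called divisorial if it is the intersection of all principal fractional ideals $cR$ ($c\in K$) containing it; for a nonzero ideal $\mathfrak a$ of $R$ let $\tilde{\mathfrak a}$ be the intersection of all principal fractional ideals containing $\mathfrak a$. Let $M^{**}$ be the set of nonzero divisorial ideals of $R$ (equivalently, the integral divisors $D^+$ of $R$), ordered by reverse inclusion ($I\leqslant J$ iff $J\subseteq I$) and with product $I\cdot J=\widetilde{IJ}$; it is an ordered commutative monoid whose least element is its unit $1=R$. Let $A_t$ be the set of atoms of $M^{**}$ (the minimal elements $>1$) and $E=\{e^n : e\in A_t,\ n\ge 1\}$. Call $J\in M^{**}$ $\vee$-irreducible if, whenever $J$ is the join (least upper bound) of a finite subset $A\subseteq M^{**}$ (possibly empty, with join $1$), then $J\in A$. Say that DCC holds if every sequence $J_1\geqslant J_2\geqslant\cdots$ in $M^{**}$ is eventually constant. **Theorem 3.1.** For every integral domain $R$ the following conditions are equivalent. 1. $R$ is a Krull domain: there is a family of discrete valuations of $K$ (with value group $\mathbb Z$) such that $R$ is the intersection of their valuation rings and each nonzero $x\in K$ has value $0$ at all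 but finitely many of them. 2. ($D_6$) Every $J\in M^{**}$ is the join of a finite (possibly empty) set of powers of atoms. 3. DCC holds in $M^{**}$, and every $\vee$-irreducible element of $M^{**}$ belongs to $E$. 4. In $M^{**}$: the product distributes over joins, i.e. $a\cdot(b\vee c)=(a\cdot b)\vee(a\cdot c)$ for all $a,b,c$ (if either side exists, so does the other and both are equal); the cancellation law holds ($xz=yz$ implies $x=y$); the order is defined by the product ($a\leqslant b$ iff $b=a\cdot c$ for some $c$); and DCC holds. 5. $M^{**}$ is isomorphic, as an ordered monoid, to $\bigoplus_{e\in A_t}\mathbb N$, i.e. to the families $(n_e)_{e\in A_t}$ of natural numbers with finite support, with componentwise addition and order. -/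

import Mathlib

section OrderedMonoid

variable (X : Type*) [CommMonoid X] [PartialOrder X] [OrderBot X]

/-- The set `E` of all powers `e ^ n`, `n = 1, 2, …`, of atoms `e` of `X`. -/
def atomPowers : Set X := {x | ∃ e : X, IsAtom e ∧ ∃ n : ℕ, 1 ≤ n ∧ x = e ^ n}

/-- Condition `D₆`: every element is the join (least upper bound) of a finite set of powers of
atoms; the empty set is allowed and has the least element as its join. -/
def ConditionD6 : Prop :=
  ∀ x : X, ∃ A : Set X, A.Finite ∧ A ⊆ atomPowers X ∧ IsLUB A x

end OrderedMonoid

/-- Descending chain condition: every descending sequence `a 0 ≥ a 1 ≥ ⋯` is eventually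
constant. -/
def DescendingChains (X : Type*) [PartialOrder X] : Prop :=
  ∀ a : ℕ → X, Antitone a → ∃ m, ∀ i, m ≤ i → a i = a m

/-- `x` is join-irreducible: whenever `x` is the join of a finite set `A`, then `x ∈ A`.
(With `A = ∅`, the least element is not join-irreducible.) -/
def JoinIrreducible {X : Type*} [PartialOrder X] (x : X) : Prop :=
  ∀ A : Set X, A.Finite → IsLUB A x → x ∈ A

/-- Distributivity of the product over joins: `a (b ∨ c) = ab ∨ ac`, meaning that if either side
exists, then so does the other one, and both are equal. -/
def MulDistribJoin (X : Type*) [CommMonoid X] [PartialOrder X] : Prop :=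
  ∀ a b c : X,
    (∀ d, IsLUB {b, c} d → IsLUB {a * b, a * c} (a * d)) ∧
    (∀ d, IsLUB {a * b, a * c} d → ∃ d', IsLUB {b, c} d' ∧ d = a * d')

/-- Cancellation law. -/
def CancellationLaw (X : Type*) [CommMonoid X] : Prop :=
  ∀ x y z : X, x * z = y * z → x = y

/-- The order is defined by the product: `a ≤ b` iff `b = a c` for some `c`. -/
def OrderDefinedByMul (X : Type*) [CommMonoid X] [PartialOrder X] : Prop :=
  ∀ a b : X, a ≤ b ↔ ∃ c, b = a * c

section Domain

variable (R : Type*) [CommRing R]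

/-- A domain `R` with fraction field `K` is a Krull domain if there is a set `S` of discrete
(normalized, i.e. surjective onto `ℤ ∪ {∞}`, written multiplicatively) valuations of `K` such that
`R` is the intersection of their valuation rings and every nonzero `x : K` has value zero
(multiplicatively: `v x = 1`) at all but finitely many `v ∈ S`. -/
def IsKrullDomain : Prop :=
  ∃ S : Set (Valuation (FractionRing R) (WithZero (Multiplicative ℤ))),
    (∀ v ∈ S, Function.Surjective v) ∧
    (∀ x : FractionRing R,
      x ∈ Set.range (algebraMap R (FractionRing R)) ↔ ∀ v ∈ S, v x ≤ 1) ∧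
    (∀ x : FractionRing R, x ≠ 0 → {v ∈ S | v x ≠ 1}.Finite)

variable {R}

/-- `R ∩ cR` for an element `c` of the fraction field. -/
def principalTrace (c : FractionRing R) : Ideal R :=
  (Submodule.span R {c}).comap (Algebra.linearMap R (FractionRing R))

/-- The divisorial closure of an integral ideal `I`: the intersection of all principal
fractional ideals `cR` that contain `I`. It is contained in `R`, as `R` itself is such a `cR`. -/
def divisorialClosure (I : Ideal R) : Ideal R :=
  sInf {J | ∃ c : FractionRing R, J = principalTrace c ∧ I ≤ principalTrace c}

theorem mem_principalTrace {c : FractionRing R} {x : R} :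
    x ∈ principalTrace c ↔ ∃ r : R, r • c = algebraMap R (FractionRing R) x := by
  simp [principalTrace, Submodule.mem_span_singleton]

theorem mem_divisorialClosure {I : Ideal R} {x : R} :
    x ∈ divisorialClosure I ↔
      ∀ c : FractionRing R, I ≤ principalTrace c → x ∈ principalTrace c := by
  simp only [divisorialClosure, Submodule.mem_sInf, Set.mem_ofPred_eq]
  constructor
  · intro h c hc
    exact h _ ⟨c, rfl, hc⟩
  · rintro h _ ⟨c, rfl, hc⟩
    exact h c hc

theorem le_divisorialClosure (I : Ideal R) : I ≤ divisorialClosure I := fun _ hx =>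
  mem_divisorialClosure.2 fun _ hc => hc hx

theorem divisorialClosure_le {I J : Ideal R} (h : I ≤ divisorialClosure J) :
    divisorialClosure I ≤ divisorialClosure J := fun _ hx =>
  mem_divisorialClosure.2 fun c hc =>
    mem_divisorialClosure.1 hx c fun _ hy => mem_divisorialClosure.1 (h hy) c hc

theorem divisorialClosure_idem (I : Ideal R) :
    divisorialClosure (divisorialClosure I) = divisorialClosure I :=
  le_antisymm (divisorialClosure_le le_rfl) (le_divisorialClosure _)

theorem divisorialClosure_mul_le [IsDomain R] (I J : Ideal R) :
    divisorialClosure I * J ≤ divisorialClosure (I * J) := by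
  rw [Ideal.mul_le]
  intro x hx y hy
  rw [mem_divisorialClosure]
  intro c hc
  by_cases hy0 : y = 0
  · simp [hy0]
  have hyK : algebraMap R (FractionRing R) y ≠ 0 := by simpa using hy0
  have h1 : x ∈ principalTrace (c / algebraMap R (FractionRing R) y) := by
    refine mem_divisorialClosure.1 hx _ fun z hz => ?_
    obtain ⟨r, hr⟩ := mem_principalTrace.1 (hc (Ideal.mul_mem_mul hz hy))
    refine mem_principalTrace.2 ⟨r, ?_⟩
    rw [Algebra.smul_def] at hr ⊢
    rw [← mul_div_assoc, hr, map_mul, mul_div_assoc, div_self hyK, mul_one]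
  obtain ⟨r, hr⟩ := mem_principalTrace.1 h1
  refine mem_principalTrace.2 ⟨r, ?_⟩
  rw [Algebra.smul_def] at hr ⊢
  rw [map_mul, ← hr, mul_assoc, div_mul_cancel₀ _ hyK]

theorem divisorialClosure_closure_mul [IsDomain R] (I J : Ideal R) :
    divisorialClosure (divisorialClosure I * J) = divisorialClosure (I * J) :=
  le_antisymm (divisorialClosure_le (divisorialClosure_mul_le I J))
    (divisorialClosure_le
      ((Ideal.mul_mono_left (le_divisorialClosure I)).trans (le_divisorialClosure _)))

variable (R)

/-- The collection `M**` of integral divisors of `R`: each integral divisor is represented by its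
unique divisorial ideal, i.e. by a nonzero ideal `I` of `R` that is the intersection of the
principal fractional ideals containing it. -/
@[ext]
structure IntegralDivisor where
  /-- the divisorial ideal of the divisor -/
  ideal : Ideal R
  ne_bot : ideal ≠ ⊥
  divisorial : divisorialClosure ideal = ideal

end Domain

namespace IntegralDivisor

variable {R : Type*} [CommRing R]

/-- Divisors are ordered by reverse inclusion of their divisorial ideals. -/
instance : PartialOrder (IntegralDivisor R) where
  le I J := J.ideal ≤ I.ideal
  le_refl _ := le_rfl
  le_trans _ _ _ h h' := le_trans h' h
  le_antisymm _ _ h h' := IntegralDivisor.ext (le_antisymm h' h)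

theorem le_iff (I J : IntegralDivisor R) : I ≤ J ↔ J.ideal ≤ I.ideal := Iff.rfl

variable [IsDomain R]

/-- `div I + div J = div (I J)`, written multiplicatively. -/
instance : Mul (IntegralDivisor R) where
  mul I J :=
    { ideal := divisorialClosure (I.ideal * J.ideal)
      ne_bot := fun h => by
        have h1 := le_divisorialClosure (I.ideal * J.ideal)
        rw [h, le_bot_iff, Ideal.mul_eq_bot] at h1
        exact h1.elim I.ne_bot J.ne_bot
      divisorial := divisorialClosure_idem _ }

/-- The divisor of the unit ideal. -/
instance : One (IntegralDivisor R) where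
  one :=
    { ideal := ⊤
      ne_bot := top_ne_bot
      divisorial := top_le_iff.1 (le_divisorialClosure _) }

theorem mul_ideal (I J : IntegralDivisor R) :
    (I * J).ideal = divisorialClosure (I.ideal * J.ideal) := rfl

theorem one_ideal : (1 : IntegralDivisor R).ideal = ⊤ := rfl

instance : CommMonoid (IntegralDivisor R) where
  mul_assoc I J K := by
    ext1
    simp only [mul_ideal]
    rw [divisorialClosure_closure_mul, mul_comm I.ideal (divisorialClosure _),
      divisorialClosure_closure_mul, mul_assoc, mul_comm I.ideal]
  one_mul I := by
    ext1
    rw [mul_ideal, one_ideal, Ideal.top_mul, I.divisorial]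
  mul_one I := by
    ext1
    rw [mul_ideal, one_ideal, Ideal.mul_top, I.divisorial]
  mul_comm I J := by
    ext1
    rw [mul_ideal, mul_ideal, mul_comm]

/-- The least divisor is the unit `1`. -/
instance : OrderBot (IntegralDivisor R) where
  bot := 1
  bot_le _ := le_top (α := Ideal R)

instance : IsOrderedMonoid (IntegralDivisor R) where
  mul_le_mul_left I J h K := by
    rw [le_iff, mul_ideal, mul_ideal]
    exact divisorialClosure_le ((Ideal.mul_mono_left h).trans (le_divisorialClosure _))

end IntegralDivisor

/-! The theorem is unique factorization for divisors. Two facts hold in every domain. Atoms are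
prime (`le_or_le_of_isAtom_of_le_mul`): if an atom is not below `x`, the two ideals have a sum with
divisorial closure `R`. Principal divisors can be cancelled and divided out, and so can every
divisor `P` for which some `P * Q` is principal.

An ordered monoid generated by prime, cancellable atoms is free on them
(`nonempty_mulOrderIso_of_prod_atoms`), so condition 5 only requires factoring into atoms and
cancelling them. Under condition 4 this is well-founded induction. Under `D₆` the crux is
`exists_mul_eq_principal_of_conditionD6`: every atom divides a principal divisor.

In the free monoid, the exponents of principal divisors are discrete valuations defining `R`, so `R`
is Krull. Conversely a Krull domain is completely integrally closed, which makes every divisor a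
factor of a principal one (`mul_residual_eq_principal`); finiteness of the set of valuations
nontrivial at a given element yields DCC. Conditions 2 and 3 are linked by decomposing reducible
elements, with DCC in 3 obtained through the Krull property. -/

theorem DescendingChains.wellFoundedLT {X : Type*} [PartialOrder X] (h : DescendingChains X) :
    WellFoundedLT X := by
  refine (wellFoundedGT_iff_monotone_chain_condition (α := Xᵒᵈ)).2 fun a => ?_
  obtain ⟨m, hm⟩ := h (fun n => OrderDual.ofDual (a n)) fun i j hij => a.monotone hij
  exact ⟨m, fun i hi => (hm i hi).symm⟩

/-! ### Factorization in ordered monoids -/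

section OrderedMonoid

variable {X : Type*} [CommMonoid X] [PartialOrder X] [OrderBot X]

theorem ConditionD6.mem_atomPowers (h : ConditionD6 X) {x : X} (hx : JoinIrreducible x) :
    x ∈ atomPowers X := by
  obtain ⟨A, hfin, hA, hlub⟩ := h x
  exact hA (hx A hfin hlub)

theorem DescendingChains.conditionD6 (h : DescendingChains X)
    (hirr : ∀ x : X, JoinIrreducible x → x ∈ atomPowers X) : ConditionD6 X := by
  have := h.wellFoundedLT
  intro x
  induction x using WellFoundedLT.induction with
  | ind x ih =>
    by_cases hx : JoinIrreducible x
    · exact ⟨{x}, Set.finite_singleton x, by simpa using hirr x hx, isLUB_singleton⟩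
    -- A reducible `x` is a finite join of strictly smaller elements; their decompositions are
    -- pooled. The case `A = ∅` covers `⊥`.
    · simp only [JoinIrreducible, not_forall] at hx
      obtain ⟨A, hfin, hlub, hxA⟩ := hx
      have hlt : ∀ y ∈ A, y < x := fun y hy =>
        lt_of_le_of_ne (hlub.1 hy) fun h => hxA (h ▸ hy)
      choose! B hBfin hB hBlub using fun y hy => ih y (hlt y hy)
      refine ⟨⋃ y ∈ A, B y, hfin.biUnion hBfin, Set.iUnion₂_subset hB, ?_, fun u hu => ?_⟩
      · intro z hz
        obtain ⟨y, hy, hzy⟩ := Set.mem_iUnion₂.1 hz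
        exact ((hBlub y hy).1 hzy).trans (hlub.1 hy)
      · refine hlub.2 fun y hy => (hBlub y hy).2 fun z hz => hu (Set.mem_iUnion₂.2 ⟨y, hy, hz⟩)

theorem IsAtom.ne_one_of_bot_eq_one (hone : (⊥ : X) = 1) {e : X} (he : IsAtom e) : e ≠ 1 :=
  hone ▸ he.1

/-- A finitely supported family is the supremum of its one-coordinate parts, and these are powers of
atoms. -/
theorem conditionD6_of_mulOrderIso (hone : (⊥ : X) = 1) {ι : Type*}
    (φ : X ≃*o Multiplicative (ι →₀ ℕ)) : ConditionD6 X := by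
  classical
  have key : ∀ (i : ι) (n : ℕ), φ.symm (Multiplicative.ofAdd (Finsupp.single i n)) =
      φ.symm (Multiplicative.ofAdd (Finsupp.single i 1)) ^ n := by
    intro i n
    rw [← map_pow, ← ofAdd_nsmul, Finsupp.smul_single, smul_eq_mul, mul_one]
  have hle : ∀ (x : X) (f : ι →₀ ℕ), φ.symm (Multiplicative.ofAdd f) ≤ x ↔
      f ≤ Multiplicative.toAdd (φ x) := fun x f => by
    rw [← map_le_map_iff φ, OrderMonoidIso.apply_symm_apply]; rfl
  have hge : ∀ (x : X) (f : ι →₀ ℕ), x ≤ φ.symm (Multiplicative.ofAdd f) ↔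
      Multiplicative.toAdd (φ x) ≤ f := fun x f => by
    rw [← map_le_map_iff φ, OrderMonoidIso.apply_symm_apply]; rfl
  have hatom : ∀ i, IsAtom (φ.symm (Multiplicative.ofAdd (Finsupp.single i 1))) := by
    intro i
    refine ⟨fun h => ?_, fun x hx => ?_⟩
    · have := (hge _ 0).1 (h.le.trans bot_le)
      have := this i
      simp at this
    · have h1 := (hge _ _).1 hx.le
      have h2 : ¬ Finsupp.single i 1 ≤ Multiplicative.toAdd (φ x) :=
        fun h => hx.not_ge ((hle _ _).2 h)
      rw [Finsupp.single_le_iff] at h2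
      have h3 : Multiplicative.toAdd (φ x) = 0 := by
        ext j
        have := h1 j
        by_cases hj : i = j
        · subst hj; simp at this ⊢; omega
        · simpa [Finsupp.single_apply, hj] using this
      have h4 : φ x = 1 := h3
      rw [hone]
      exact (map_eq_one_iff φ φ.injective).1 h4
  intro x
  set f := Multiplicative.toAdd (φ x) with hf
  refine ⟨(fun i => φ.symm (Multiplicative.ofAdd (Finsupp.single i (f i)))) '' f.support,
    f.support.finite_toSet.image _, ?_, ?_, fun u hu => ?_⟩
  · rintro _ ⟨i, hi, rfl⟩
    refine ⟨_, hatom i, f i, ?_, key i _⟩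
    have := Finsupp.mem_support_iff.1 hi
    omega
  · rintro _ ⟨i, hi, rfl⟩
    exact (hle _ _).2 (by rw [Finsupp.single_le_iff])
  · rw [← map_le_map_iff φ]
    intro i
    by_cases hi : i ∈ f.support
    · have := (hle _ _).1 (hu ⟨i, hi, rfl⟩)
      rwa [Finsupp.single_le_iff] at this
    · have : f i = 0 := by simpa using hi
      change f i ≤ _
      omega

theorem IsAtom.mem_of_le_prod (hone : (⊥ : X) = 1)
    (hprime : ∀ e x y : X, IsAtom e → e ≤ x * y → e ≤ x ∨ e ≤ y) {e : X} (he : IsAtom e)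
    {s : Multiset X} (hs : ∀ a ∈ s, IsAtom a) (h : e ≤ s.prod) : e ∈ s := by
  induction s using Multiset.induction with
  | empty =>
    rw [Multiset.prod_zero, ← hone] at h
    exact absurd (le_bot_iff.1 h) he.1
  | cons a s ih =>
    rw [Multiset.prod_cons] at h
    rcases hprime _ _ _ he h with h | h
    · have ha := hs a (Multiset.mem_cons_self _ _)
      rw [Multiset.mem_cons]
      exact Or.inl ((ha.le_iff.1 h).resolve_left he.1)
    · exact Multiset.mem_cons_of_mem (ih (fun b hb => hs b (Multiset.mem_cons_of_mem hb)) h)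

/-- Induction on the number of atoms in the bound: an atom below `x` is prime, hence occurs in the
bound, and can be removed from both sides. -/
theorem exists_multiset_prod_of_le_prod (hone : (⊥ : X) = 1)
    (hprime : ∀ e x y : X, IsAtom e → e ≤ x * y → e ≤ x ∨ e ≤ y)
    (hcancel : ∀ e x y : X, IsAtom e → e * x ≤ e * y → x ≤ y)
    (hdvd : ∀ e x : X, IsAtom e → e ≤ x → ∃ y, x = e * y)
    (hatomic : ∀ x : X, x ≠ 1 → ∃ e, IsAtom e ∧ e ≤ x)
    {s : Multiset X} (hs : ∀ a ∈ s, IsAtom a) {x : X} (hx : x ≤ s.prod) :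
    ∃ t : Multiset X, (∀ a ∈ t, IsAtom a) ∧ x = t.prod := by
  classical
  induction hn : s.card generalizing s x with
  | zero =>
    rw [Multiset.card_eq_zero] at hn
    subst hn
    refine ⟨0, by simp, ?_⟩
    rw [Multiset.prod_zero, ← hone] at hx ⊢
    exact le_bot_iff.1 hx
  | succ n ih =>
    by_cases h1 : x = 1
    · exact ⟨0, by simp, by simpa using h1⟩
    obtain ⟨e, he, hex⟩ := hatomic x h1
    obtain ⟨y, rfl⟩ := hdvd e x he hex
    have hes := he.mem_of_le_prod hone hprime hs (hex.trans hx)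
    obtain ⟨s', rfl⟩ := Multiset.exists_cons_of_mem hes
    rw [Multiset.prod_cons] at hx
    obtain ⟨t, ht, rfl⟩ := ih (fun a ha => hs a (Multiset.mem_cons_of_mem ha))
      (hcancel _ _ _ he hx) (by simpa using hn)
    exact ⟨e ::ₘ t, by simpa [he] using ht, by simp⟩

variable [IsOrderedMonoid X]

theorem le_mul_of_bot_eq_one (hone : (⊥ : X) = 1) (x y : X) : x ≤ x * y := by
  simpa using mul_le_mul_right (hone ▸ bot_le : 1 ≤ y) x

theorem exists_multiset_prod_of_wellFoundedLT [WellFoundedLT X] (hone : (⊥ : X) = 1)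
    (hcancel : CancellationLaw X) (hdvd : OrderDefinedByMul X) (x : X) :
    ∃ t : Multiset X, (∀ a ∈ t, IsAtom a) ∧ x = t.prod := by
  induction x using WellFoundedLT.induction with
  | ind x ih =>
    obtain rfl | ⟨e, he, hex⟩ := (IsAtomic.eq_bot_or_exists_atom_le x)
    · exact ⟨0, by simp, by simpa using hone⟩
    obtain ⟨y, rfl⟩ := (hdvd e x).1 hex
    have hy : y < e * y := by
      refine lt_of_le_of_ne (by rw [mul_comm]; exact le_mul_of_bot_eq_one hone _ _) fun h => ?_
      exact he.ne_one_of_bot_eq_one hone (hcancel _ _ y (by rw [← h, one_mul]))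
    obtain ⟨t, ht, rfl⟩ := ih y hy
    exact ⟨e ::ₘ t, by simpa [he] using ht, by simp⟩

/-- Multiplication by `a` is an order isomorphism onto the elements above `a`, where all upper
bounds of `a * b` lie; hence it preserves and reflects joins. -/
theorem mulDistribJoin_of_cancel (hone : (⊥ : X) = 1) (hcancel : CancellationLaw X)
    (hdvd : OrderDefinedByMul X) : MulDistribJoin X := by
  have hle : ∀ a x y : X, a * x ≤ a * y ↔ x ≤ y := by
    refine fun a x y => ⟨fun h => ?_, fun h => mul_le_mul_right h a⟩
    obtain ⟨z, hz⟩ := (hdvd _ _).1 h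
    refine (hdvd _ _).2 ⟨z, hcancel _ _ a ?_⟩
    rw [mul_comm y, hz, mul_assoc, mul_comm]
  refine fun a b c => ⟨fun d hd => ⟨?_, fun u hu => ?_⟩, fun d hd => ?_⟩
  · rintro _ (rfl | rfl)
    · exact mul_le_mul_right (hd.1 (by simp)) a
    · exact mul_le_mul_right (hd.1 (by simp)) a
  · have hb : a * b ≤ u := hu (by simp)
    have hc : a * c ≤ u := hu (by simp)
    obtain ⟨w, rfl⟩ := (hdvd _ _).1 ((le_mul_of_bot_eq_one hone a b).trans hb)
    rw [hle] at hb hc ⊢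
    exact hd.2 (by rintro _ (rfl | rfl) <;> assumption)
  · have hb : a * b ≤ d := hd.1 (by simp)
    have hc : a * c ≤ d := hd.1 (by simp)
    obtain ⟨w, rfl⟩ := (hdvd _ _).1 ((le_mul_of_bot_eq_one hone a b).trans hb)
    rw [hle] at hb hc
    refine ⟨w, ⟨by rintro _ (rfl | rfl) <;> assumption, fun u hu => ?_⟩, rfl⟩
    rw [← hle a]
    refine hd.2 ?_
    rintro _ (rfl | rfl)
    · exact mul_le_mul_right (hu (by simp)) a
    · exact mul_le_mul_right (hu (by simp)) a

/-- An ordered monoid in which every element is a product of atoms, and in which the atoms are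
prime and cancellable, is free on its atoms. -/
theorem nonempty_mulOrderIso_of_prod_atoms (hone : (⊥ : X) = 1)
    (hprime : ∀ e x y : X, IsAtom e → e ≤ x * y → e ≤ x ∨ e ≤ y)
    (hcancel : ∀ e x y : X, IsAtom e → e * x ≤ e * y → x ≤ y)
    (hprod : ∀ x : X, ∃ t : Multiset X, (∀ a ∈ t, IsAtom a) ∧ x = t.prod) :
    Nonempty (X ≃*o Multiplicative ({e : X // IsAtom e} →₀ ℕ)) := by
  classical
  let A := {e : X // IsAtom e}
  let Φ : Multiplicative (A →₀ ℕ) →* X :=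
    { toFun := fun f => ((Finsupp.toMultiset (Multiplicative.toAdd f)).map Subtype.val).prod
      map_one' := by simp
      map_mul' := fun f g => by simp }
  -- Uniqueness of factorization in order form: the product reflects the order, hence is injective.
  have hle : ∀ s t : Multiset A, (s.map Subtype.val).prod ≤ (t.map Subtype.val).prod → s ≤ t := by
    intro s
    induction s using Multiset.induction with
    | empty => simp
    | cons a s ih =>
      intro t h
      rw [Multiset.map_cons, Multiset.prod_cons] at h
      have := a.2.mem_of_le_prod hone hprime (by simp +contextual)
        ((le_mul_of_bot_eq_one hone _ _).trans h)
      obtain ⟨b, hb, hba⟩ := Multiset.mem_map.1 this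
      obtain rfl := Subtype.ext hba
      obtain ⟨t', rfl⟩ := Multiset.exists_cons_of_mem hb
      rw [Multiset.map_cons, Multiset.prod_cons] at h
      exact Multiset.cons_le_cons _ (ih t' (hcancel _ _ _ b.2 h))
  have hΦ : ∀ f g, Φ f ≤ Φ g ↔ f ≤ g := by
    intro f g
    constructor
    · intro h
      have := hle _ _ h
      exact (Finsupp.orderIsoMultiset (ι := A)).le_iff_le.1 this
    · intro h
      obtain ⟨k, hk⟩ := exists_add_of_le
        (show Multiplicative.toAdd f ≤ Multiplicative.toAdd g from h)
      have : g = f * Multiplicative.ofAdd k := hk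
      rw [this, map_mul]
      exact le_mul_of_bot_eq_one hone _ _
  have hinj : Function.Injective Φ := fun f g h =>
    le_antisymm ((hΦ _ _).1 h.le) ((hΦ _ _).1 h.ge)
  have hsurj : Function.Surjective Φ := by
    intro x
    obtain ⟨t, ht, rfl⟩ := hprod x
    lift t to Multiset A using ht
    exact ⟨Multiplicative.ofAdd (Multiset.toFinsupp t), by simp [Φ]⟩
  exact ⟨OrderMonoidIso.symm
    { MulEquiv.ofBijective Φ ⟨hinj, hsurj⟩ with map_le_map_iff' := hΦ _ _ }⟩

end OrderedMonoid

/-! ### Prime atoms, principal divisors and residuals -/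

namespace IntegralDivisor

variable {R : Type*} [CommRing R]

theorem mem_ideal_iff (J : IntegralDivisor R) (x : R) :
    x ∈ J.ideal ↔ ∀ c : FractionRing R, J.ideal ≤ principalTrace c → x ∈ principalTrace c := by
  rw [← mem_divisorialClosure, J.divisorial]

theorem divisorialClosure_le_ideal_iff (I : Ideal R) (J : IntegralDivisor R) :
    divisorialClosure I ≤ J.ideal ↔ I ≤ J.ideal := by
  refine ⟨(le_divisorialClosure I).trans, fun h => ?_⟩
  rw [← J.divisorial] at h ⊢
  exact divisorialClosure_le h

theorem principalTrace_algebraMap (x : R) :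
    principalTrace (algebraMap R (FractionRing R) x) = Ideal.span {x} := by
  ext y
  rw [mem_principalTrace, Ideal.mem_span_singleton']
  refine exists_congr fun r => ?_
  rw [Algebra.smul_def, ← map_mul, (IsFractionRing.injective R (FractionRing R)).eq_iff]

theorem exists_mem_ne_zero (J : IntegralDivisor R) : ∃ x ∈ J.ideal, x ≠ 0 :=
  Submodule.exists_mem_ne_zero_of_ne_bot J.ne_bot

/-- The divisor of a nonzero ideal. -/
def ofIdeal (I : Ideal R) (hI : I ≠ ⊥) : IntegralDivisor R where
  ideal := divisorialClosure I
  ne_bot h := hI (le_bot_iff.1 ((le_divisorialClosure I).trans h.le))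
  divisorial := divisorialClosure_idem I

/-- The divisor of a nonzero element. -/
def principal (x : R) (hx : x ≠ 0) : IntegralDivisor R where
  ideal := Ideal.span {x}
  ne_bot := by simpa using hx
  divisorial := by
    refine le_antisymm (fun y hy => ?_) (le_divisorialClosure _)
    rw [← principalTrace_algebraMap] at hy ⊢
    exact mem_divisorialClosure.1 hy _ le_rfl

theorem principal_ideal (x : R) (hx : x ≠ 0) : (principal x hx).ideal = Ideal.span {x} := rfl

theorem le_principal_iff {x : R} {hx : x ≠ 0} {J : IntegralDivisor R} :
    J ≤ principal x hx ↔ x ∈ J.ideal := by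
  rw [le_iff, principal_ideal, Ideal.span_singleton_le_iff_mem]

theorem principal_le_principal_iff {x y : R} {hx : x ≠ 0} {hy : y ≠ 0} :
    principal x hx ≤ principal y hy ↔ x ∣ y := by
  rw [le_principal_iff, principal_ideal, Ideal.mem_span_singleton]

variable [IsDomain R]

theorem bot_eq_one : (⊥ : IntegralDivisor R) = 1 := rfl

theorem le_mul_iff {I J K : IntegralDivisor R} : K ≤ I * J ↔ I.ideal * J.ideal ≤ K.ideal := by
  rw [le_iff, mul_ideal, divisorialClosure_le_ideal_iff]

/-- If `1` is the only common lower bound of `a` and `b`, then `a` can be cancelled in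
`b ≤ a * c`. -/
theorem le_of_le_mul_of_coprime {a b c : IntegralDivisor R}
    (hab : ∀ d, d ≤ a → d ≤ b → d = 1) (h : b ≤ a * c) : b ≤ c := by
  have hne : a.ideal ⊔ b.ideal ≠ ⊥ := fun h => a.ne_bot (sup_eq_bot_iff.1 h).1
  have h1 : divisorialClosure (a.ideal ⊔ b.ideal) = ⊤ :=
    congrArg IntegralDivisor.ideal (hab (ofIdeal _ hne)
      ((le_sup_left : a.ideal ≤ _).trans (le_divisorialClosure _))
      ((le_sup_right : b.ideal ≤ _).trans (le_divisorialClosure _)))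
  rw [le_mul_iff] at h
  rw [le_iff]
  -- Coprimality replaces `R` by the closure of `a + b`; then `(a + b)c` lies in `b`, since `ac`
  -- does by hypothesis.
  calc c.ideal = divisorialClosure (a.ideal ⊔ b.ideal) * c.ideal := by rw [h1, Ideal.top_mul]
    _ ≤ divisorialClosure ((a.ideal ⊔ b.ideal) * c.ideal) := divisorialClosure_mul_le _ _
    _ ≤ b.ideal := by
      rw [divisorialClosure_le_ideal_iff, Ideal.sup_mul]
      exact sup_le h Ideal.mul_le_left

theorem eq_one_of_le_isAtom_of_not_le {e x : IntegralDivisor R} (he : IsAtom e) (hex : ¬ e ≤ x)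
    (d : IntegralDivisor R) (hde : d ≤ e) (hdx : d ≤ x) : d = 1 := by
  rcases he.le_iff.1 hde with rfl | rfl
  · rfl
  · exact absurd hdx hex

/-- Atoms of the monoid of divisors are prime. -/
theorem le_or_le_of_isAtom_of_le_mul (e x y : IntegralDivisor R) (he : IsAtom e)
    (h : e ≤ x * y) : e ≤ x ∨ e ≤ y := by
  refine or_iff_not_imp_left.2 fun hex => le_of_le_mul_of_coprime (a := x) (b := e) ?_ h
  exact fun d hdx hde => eq_one_of_le_isAtom_of_not_le he hex d hde hdx

theorem le_of_isAtom_of_le_pow {e x : IntegralDivisor R} (he : IsAtom e) {n : ℕ}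
    (h : e ≤ x ^ n) : e ≤ x := by
  induction n with
  | zero => exact absurd (le_bot_iff.1 (by simpa [bot_eq_one] using h)) he.1
  | succ n ih =>
    rw [pow_succ] at h
    exact (le_or_le_of_isAtom_of_le_mul _ _ _ he h).elim ih id

theorem principal_mul_principal {x y : R} (hx : x ≠ 0) (hy : y ≠ 0) :
    principal x hx * principal y hy = principal (x * y) (mul_ne_zero hx hy) := by
  ext1
  rw [mul_ideal, principal_ideal, principal_ideal, Ideal.span_singleton_mul_span_singleton]
  exact (principal (x * y) (mul_ne_zero hx hy)).divisorial

theorem mul_mem_principalTrace_mul_iff {x z : R} (hx : x ≠ 0) {c : FractionRing R} :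
    x * z ∈ principalTrace (algebraMap R (FractionRing R) x * c) ↔ z ∈ principalTrace c := by
  have hx' : algebraMap R (FractionRing R) x ≠ 0 := by simpa using hx
  simp only [mem_principalTrace, map_mul]
  refine exists_congr fun r => ?_
  rw [Algebra.smul_def, Algebra.smul_def, mul_left_comm, mul_right_inj' hx']

/-- No closure is needed: scaling by `x` carries each `cR` containing `J` to `xcR` containing `xJ`.
-/
theorem principal_mul_ideal {x : R} (hx : x ≠ 0) (J : IntegralDivisor R) :
    (principal x hx * J).ideal = Ideal.span {x} * J.ideal := by
  refine le_antisymm (fun y hy => ?_) (le_divisorialClosure _)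
  have hxy : y ∈ Ideal.span {x} :=
    (divisorialClosure_le_ideal_iff _ (principal x hx)).2 Ideal.mul_le_left hy
  obtain ⟨z, rfl⟩ := Ideal.mem_span_singleton.1 hxy
  refine Ideal.mul_mem_mul (Ideal.mem_span_singleton_self x) ((J.mem_ideal_iff z).2 fun c hc => ?_)
  rw [← mul_mem_principalTrace_mul_iff hx]
  refine mem_divisorialClosure.1 hy _ ?_
  rw [principal_ideal, Ideal.span_singleton_mul_le_iff]
  exact fun w hw => (mul_mem_principalTrace_mul_iff hx).2 (hc hw)

theorem principal_mul_le_mul_iff {x : R} (hx : x ≠ 0) {I J : IntegralDivisor R} :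
    principal x hx * I ≤ principal x hx * J ↔ I ≤ J := by
  rw [le_iff, principal_mul_ideal, principal_mul_ideal, le_iff,
    Ideal.span_singleton_mul_right_mono hx]

/-- The residual of `J` by `I`, i.e. the ideal quotient of the divisorial ideals. -/
def residual (J I : IntegralDivisor R) : IntegralDivisor R where
  ideal := J.ideal.colon (I.ideal : Set R)
  ne_bot h := J.ne_bot (le_bot_iff.1 (Ideal.le_colon.trans h.le))
  divisorial := by
    refine le_antisymm (fun x hx => ?_) (le_divisorialClosure _)
    refine Submodule.mem_colon.2 fun y hy => ?_
    refine (divisorialClosure_le_ideal_iff _ J).2 ?_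
      (divisorialClosure_mul_le (J.ideal.colon (I.ideal : Set R)) I.ideal (Ideal.mul_mem_mul hx hy))
    exact Ideal.mul_le.2 fun a ha b hb => Submodule.mem_colon.1 ha b hb

theorem mem_residual_ideal {I J : IntegralDivisor R} {x : R} :
    x ∈ (residual J I).ideal ↔ ∀ y ∈ I.ideal, x * y ∈ J.ideal :=
  Submodule.mem_colon

theorem le_mul_residual (I J : IntegralDivisor R) : J ≤ I * residual J I := by
  rw [le_mul_iff, Ideal.mul_le]
  intro x hx y hy
  rw [mul_comm]
  exact mem_residual_ideal.1 hy x hx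

theorem exists_eq_principal_mul {x : R} {hx : x ≠ 0} {J : IntegralDivisor R}
    (h : principal x hx ≤ J) : ∃ Z, J = principal x hx * Z := by
  refine ⟨residual J (principal x hx), ?_⟩
  refine le_antisymm (le_mul_residual _ _) ?_
  rw [le_iff, principal_mul_ideal]
  intro y hy
  obtain ⟨z, rfl⟩ := Ideal.mem_span_singleton.1 (h hy)
  refine Ideal.mul_mem_mul (Ideal.mem_span_singleton_self x) (mem_residual_ideal.2 fun w hw => ?_)
  obtain ⟨v, rfl⟩ := Ideal.mem_span_singleton.1 hw
  have := J.ideal.mul_mem_right v hy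
  rwa [show z * (x * v) = x * z * v by ring]

theorem le_of_mul_le_mul_of_mul_eq_principal {x : R} {hx : x ≠ 0} {P Q : IntegralDivisor R}
    (hPQ : P * Q = principal x hx) {I J : IntegralDivisor R} (h : P * I ≤ P * J) : I ≤ J := by
  rw [← principal_mul_le_mul_iff hx, ← hPQ, mul_comm P, mul_assoc, mul_assoc]
  exact mul_le_mul_right h Q

theorem exists_eq_mul_of_mul_eq_principal {x : R} {hx : x ≠ 0} {P Q : IntegralDivisor R}
    (hPQ : P * Q = principal x hx) {J : IntegralDivisor R} (h : P ≤ J) : ∃ C, J = P * C := by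
  obtain ⟨C, hC⟩ := exists_eq_principal_mul (x := x) (hx := hx) (J := J * Q)
    (by rw [← hPQ]; exact mul_le_mul_left h Q)
  refine ⟨C, ?_⟩
  have : principal x hx * J = principal x hx * (P * C) := by
    rw [← mul_assoc, mul_comm _ P, mul_assoc, ← hC, ← hPQ]
    ac_rfl
  exact le_antisymm ((principal_mul_le_mul_iff hx).1 this.le)
    ((principal_mul_le_mul_iff hx).1 this.ge)

/-- If `P ⊆ cR`, then `x = yc` with `y` in `R`, and `yP ⊆ xR`. The hypothesis then gives `y = rx`,
so `rc = 1` and `1 ∈ cR`. -/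
theorem eq_one_of_principal_le_residual {x : R} {hx : x ≠ 0} {P : IntegralDivisor R}
    (hxP : x ∈ P.ideal) (h : principal x hx ≤ residual (principal x hx) P) : P = 1 := by
  have hx' : algebraMap R (FractionRing R) x ≠ 0 := by simpa using hx
  ext1
  rw [one_ideal, Ideal.eq_top_iff_one, mem_ideal_iff]
  intro c hc
  obtain ⟨y, hy⟩ := mem_principalTrace.1 (hc hxP)
  rw [Algebra.smul_def] at hy
  have hy' : algebraMap R (FractionRing R) y ≠ 0 := fun h0 => hx' (by rw [← hy, h0, zero_mul])
  have hyQ : y ∈ (residual (principal x hx) P).ideal := by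
    refine mem_residual_ideal.2 fun p hp => ?_
    obtain ⟨r, hr⟩ := mem_principalTrace.1 (hc hp)
    refine Ideal.mem_span_singleton'.2 ⟨r, IsFractionRing.injective R (FractionRing R) ?_⟩
    rw [map_mul, map_mul, ← hr, ← hy, Algebra.smul_def]
    ring
  obtain ⟨r, rfl⟩ := Ideal.mem_span_singleton'.1 (h hyQ)
  refine mem_principalTrace.2 ⟨r, mul_left_cancel₀ hx' ?_⟩
  rw [Algebra.smul_def, map_one, mul_one]
  conv_rhs => rw [← hy, map_mul]
  ring

/-! ### Factorization into atoms under `D₆` -/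

/-- With `Q` the residual of `(x)` by `P`, one has `P * Q = (x) * Z` with `Z ≤ P`, so `Z` is `1` or
`P`. The second case is impossible: `D₆` applied to `(x)` would give `(x) ≤ Q`, forcing `P = 1`. -/
theorem exists_mul_eq_principal_of_conditionD6 (h : ConditionD6 (IntegralDivisor R))
    {P : IntegralDivisor R} (hP : IsAtom P) :
    ∃ (x : R) (hx : x ≠ 0) (Q : IntegralDivisor R), P * Q = principal x hx := by
  obtain ⟨x, hxP, hx⟩ := P.exists_mem_ne_zero
  refine ⟨x, hx, residual (principal x hx) P, ?_⟩
  set Q := residual (principal x hx) P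
  obtain ⟨Z, hZ⟩ := exists_eq_principal_mul (le_mul_residual P (principal x hx))
  have hZP : Z ≤ P := by
    rw [← principal_mul_le_mul_iff hx, ← hZ, mul_comm]
    refine mul_le_mul_left (show Q ≤ principal x hx from ?_) P
    exact le_principal_iff.2
      (mem_residual_ideal.2 fun y _ => Ideal.mul_mem_right _ _ (Ideal.mem_span_singleton_self x))
  rcases hP.le_iff.1 hZP with rfl | rfl
  · rw [hZ, bot_eq_one, mul_one]
  · refine absurd (eq_one_of_principal_le_residual (hx := hx) hxP ?_) hP.1
    obtain ⟨A, -, hA, hlub⟩ := h (principal x hx)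
    refine hlub.2 fun a ha => ?_
    obtain ⟨e, he, n, hn, rfl⟩ := hA ha
    -- Here `Z` is the atom `P`. For `e = Z`, the relation `Z * Q = (x) * Z` gives `(x) * e ^ n = Q
    -- * e ^ n ≤ Q * (x)`, and `(x)` cancels. For `e ≠ Z`, the power `e ^ n` is coprime to `Z` and
    -- lies below `Z * Q`, hence below `Q`.
    by_cases heZ : e = Z
    · subst heZ
      rw [← principal_mul_le_mul_iff hx]
      have hpow : principal x hx * e ^ n = Q * e ^ n := by
        obtain ⟨m, rfl⟩ := Nat.exists_eq_succ_of_ne_zero (by omega : n ≠ 0)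
        rw [pow_succ', ← mul_assoc, ← hZ]
        ac_rfl
      rw [hpow, mul_comm]
      exact mul_le_mul_left (hlub.1 ha) Q
    · refine le_of_le_mul_of_coprime (a := Z) (fun d hd hde => ?_)
        ((hlub.1 ha).trans (le_mul_residual _ _))
      refine eq_one_of_le_isAtom_of_not_le hP (fun hle => heZ ?_) d hd hde
      exact ((he.le_iff.1 (le_of_isAtom_of_le_pow hP hle)).resolve_left hP.1).symm

theorem exists_multiset_prod_of_conditionD6 (h : ConditionD6 (IntegralDivisor R))
    (J : IntegralDivisor R) :
    ∃ t : Multiset (IntegralDivisor R), (∀ a ∈ t, IsAtom a) ∧ J = t.prod := by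
  have hmem : ∀ a ∈ atomPowers (IntegralDivisor R),
      ∃ t : Multiset (IntegralDivisor R), (∀ b ∈ t, IsAtom b) ∧ a = t.prod := by
    rintro _ ⟨e, he, n, -, rfl⟩
    exact ⟨Multiset.replicate n e, fun b hb => Multiset.eq_of_mem_replicate hb ▸ he, by simp⟩
  obtain ⟨A, hfin, hA, hlub⟩ := h J
  -- The product of all the atom powers is an upper bound of `A`, hence bounds the join `J`.
  have hbound : ∃ t : Multiset (IntegralDivisor R), (∀ a ∈ t, IsAtom a) ∧ ∀ a ∈ A, a ≤ t.prod := by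
    clear hlub
    induction A, hfin using Set.Finite.induction_on with
    | empty => exact ⟨0, by simp, by simp⟩
    | @insert a A _ _ ih =>
      obtain ⟨t, ht, hAt⟩ := ih ((Set.subset_insert _ _).trans hA)
      obtain ⟨s, hs, rfl⟩ := hmem a (hA (Set.mem_insert _ _))
      refine ⟨s + t, fun b hb => (Multiset.mem_add.1 hb).elim (hs b) (ht b), ?_⟩
      rw [Multiset.prod_add]
      rintro b (rfl | hb)
      · exact le_mul_of_bot_eq_one bot_eq_one _ _
      · rw [mul_comm]
        exact (hAt b hb).trans (le_mul_of_bot_eq_one bot_eq_one _ _)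
  obtain ⟨s, hs, hAs⟩ := hbound
  refine exists_multiset_prod_of_le_prod bot_eq_one le_or_le_of_isAtom_of_le_mul
    (fun e x y he hle => ?_) (fun e x he hle => ?_) (fun x hx => ?_) hs (hlub.2 hAs)
  · obtain ⟨x, hx, Q, hQ⟩ := exists_mul_eq_principal_of_conditionD6 h he
    exact le_of_mul_le_mul_of_mul_eq_principal hQ hle
  · obtain ⟨x, hx, Q, hQ⟩ := exists_mul_eq_principal_of_conditionD6 h he
    exact exists_eq_mul_of_mul_eq_principal hQ hle
  · obtain ⟨B, -, hB, hBlub⟩ := h x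
    obtain rfl | ⟨b, hb⟩ := B.eq_empty_or_nonempty
    · exact absurd (le_bot_iff.1 (hBlub.2 (by simp))) hx
    · obtain ⟨e, he, n, hn, rfl⟩ := hB hb
      exact ⟨e, he, (le_self_pow (bot_le : (1 : IntegralDivisor R) ≤ e) (by omega)).trans
        (hBlub.1 hb)⟩

theorem nonempty_mulOrderIso_of_conditionD6 (h : ConditionD6 (IntegralDivisor R)) :
    Nonempty (IntegralDivisor R ≃*o
      Multiplicative ({e : IntegralDivisor R // IsAtom e} →₀ ℕ)) := by
  refine nonempty_mulOrderIso_of_prod_atoms bot_eq_one le_or_le_of_isAtom_of_le_mul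
    (fun e x y he hle => ?_) (exists_multiset_prod_of_conditionD6 h)
  obtain ⟨x, hx, Q, hQ⟩ := exists_mul_eq_principal_of_conditionD6 h he
  exact le_of_mul_le_mul_of_mul_eq_principal hQ hle

theorem nonempty_mulOrderIso_of_cancellationLaw (hcancel : CancellationLaw (IntegralDivisor R))
    (hdvd : OrderDefinedByMul (IntegralDivisor R))
    (hdcc : DescendingChains (IntegralDivisor R)) :
    Nonempty (IntegralDivisor R ≃*o
      Multiplicative ({e : IntegralDivisor R // IsAtom e} →₀ ℕ)) := by
  have := hdcc.wellFoundedLT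
  refine nonempty_mulOrderIso_of_prod_atoms bot_eq_one le_or_le_of_isAtom_of_le_mul
    (fun e x y _ hle => ?_) (exists_multiset_prod_of_wellFoundedLT bot_eq_one hcancel hdvd)
  obtain ⟨z, hz⟩ := (hdvd _ _).1 hle
  refine (hdvd _ _).2 ⟨z, hcancel _ _ e ?_⟩
  rw [mul_comm y, hz, mul_assoc, mul_comm]

/-! ### Divisors of a Krull domain -/

/-- Complete integral closedness: if `v z > 1`, the powers of `v z` exceed `(v a)⁻¹`, as the value
group is archimedean. -/
theorem algebraMap_mem_range_of_pow_mul_mem (hR : IsKrullDomain R) {z : FractionRing R} {a : R}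
    (ha : a ≠ 0) (h : ∀ n : ℕ, z ^ n * algebraMap R (FractionRing R) a ∈
      Set.range (algebraMap R (FractionRing R))) :
    z ∈ Set.range (algebraMap R (FractionRing R)) := by
  obtain ⟨S, -, hS, -⟩ := hR
  rw [hS]
  intro v hv
  by_contra! hz
  have ha' : v (algebraMap R (FractionRing R) a) ≠ 0 := by simpa using ha
  obtain ⟨n, hn⟩ := MulArchimedean.arch (v (algebraMap R (FractionRing R) a))⁻¹ hz
  have h1 := (hS _).1 (h (n + 1)) v hv
  rw [map_mul, map_pow] at h1
  have h2 : v z ^ (n + 1) ≤ (v (algebraMap R (FractionRing R) a))⁻¹ := by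
    simpa [mul_inv_cancel_right₀ ha'] using
      mul_le_mul_left h1 (v (algebraMap R (FractionRing R) a))⁻¹
  exact (pow_lt_pow_right₀ hz n.lt_succ_self).not_ge (h2.trans hn)

theorem mul_residual_eq_principal (hR : IsKrullDomain R) {a : R} {ha : a ≠ 0}
    {J : IntegralDivisor R} (haJ : a ∈ J.ideal) :
    J * residual (principal a ha) J = principal a ha := by
  refine le_antisymm ?_ (le_mul_residual _ _)
  rw [le_principal_iff, mul_ideal, mem_divisorialClosure]
  intro c hc
  have ha' : algebraMap R (FractionRing R) a ≠ 0 := by simpa using ha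
  set K := residual (principal a ha) J
  have haK : a ∈ K.ideal := mem_residual_ideal.2 fun y _ =>
    Ideal.mul_mem_right _ _ (Ideal.mem_span_singleton_self a)
  have hc0 : c ≠ 0 := by
    rintro rfl
    obtain ⟨r, hr⟩ := mem_principalTrace.1 (hc (Ideal.mul_mem_mul haJ haK))
    rw [smul_zero, map_mul] at hr
    exact mul_ne_zero ha' ha' hr.symm
  set z := algebraMap R (FractionRing R) a / c with hz
  -- From `JK ⊆ cR` follows `zKJ ⊆ aR`. As `a ∈ J`, this puts `zK` inside `R`, hence inside `K`.
  -- Iterating from `a ∈ K` keeps every `z ^ n * a` in `R`, so `z ∈ R` and `a = zc ∈ cR`.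
  have hstep : ∀ y ∈ K.ideal, ∃ w ∈ K.ideal,
      z * algebraMap R (FractionRing R) y = algebraMap R (FractionRing R) w := by
    intro y hy
    have hmul : ∀ j ∈ J.ideal, ∃ r, z * algebraMap R (FractionRing R) y *
        algebraMap R (FractionRing R) j = algebraMap R (FractionRing R) (a * r) := by
      intro j hj
      obtain ⟨r, hr⟩ := mem_principalTrace.1 (hc (Ideal.mul_mem_mul hj hy))
      refine ⟨r, ?_⟩
      rw [Algebra.smul_def, map_mul] at hr
      rw [mul_assoc, mul_comm (algebraMap R _ y), ← hr, map_mul, hz]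
      field_simp
    obtain ⟨w, hw⟩ := hmul a haJ
    rw [map_mul, mul_comm (algebraMap R (FractionRing R) a), mul_left_inj' ha'] at hw
    refine ⟨w, mem_residual_ideal.2 fun j hj => ?_, hw⟩
    obtain ⟨r, hr⟩ := hmul j hj
    rw [hw, ← map_mul, (IsFractionRing.injective R (FractionRing R)).eq_iff] at hr
    exact Ideal.mem_span_singleton.2 ⟨r, hr⟩
  have hpow : ∀ n : ℕ, ∃ w ∈ K.ideal,
      z ^ n * algebraMap R (FractionRing R) a = algebraMap R (FractionRing R) w := by
    intro n
    induction n with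
    | zero => exact ⟨a, haK, by simp⟩
    | succ n ih =>
      obtain ⟨w, hw, hzw⟩ := ih
      obtain ⟨u, hu, hzu⟩ := hstep w hw
      exact ⟨u, hu, by rw [pow_succ', mul_assoc, hzw, hzu]⟩
  obtain ⟨r, hr⟩ := algebraMap_mem_range_of_pow_mul_mem hR ha fun n => by
    obtain ⟨w, -, hw⟩ := hpow n
    exact ⟨w, hw.symm⟩
  refine mem_principalTrace.2 ⟨r, ?_⟩
  rw [Algebra.smul_def, hr, hz, div_mul_cancel₀ _ hc0]

theorem cancellationLaw_of_isKrullDomain (hR : IsKrullDomain R) :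
    CancellationLaw (IntegralDivisor R) := by
  intro I J K h
  obtain ⟨a, haK, ha⟩ := K.exists_mem_ne_zero
  have hK := mul_residual_eq_principal (ha := ha) hR haK
  rw [mul_comm I, mul_comm J] at h
  exact le_antisymm (le_of_mul_le_mul_of_mul_eq_principal hK h.le)
    (le_of_mul_le_mul_of_mul_eq_principal hK h.ge)

theorem orderDefinedByMul_of_isKrullDomain (hR : IsKrullDomain R) :
    OrderDefinedByMul (IntegralDivisor R) := by
  refine fun I J => ⟨fun h => ?_, ?_⟩
  · obtain ⟨a, haI, ha⟩ := I.exists_mem_ne_zero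
    exact exists_eq_mul_of_mul_eq_principal (mul_residual_eq_principal (ha := ha) hR haI) h
  · rintro ⟨C, rfl⟩
    exact le_mul_of_bot_eq_one bot_eq_one _ _

theorem exists_forall_valuation_le {v : Valuation (FractionRing R) (WithZero (Multiplicative ℤ))}
    (hv : ∀ x : R, v (algebraMap R (FractionRing R) x) ≤ 1) {s : Set R}
    (hs : ∃ x ∈ s, x ≠ 0) :
    ∃ x ∈ s, ∀ y ∈ s, v (algebraMap R (FractionRing R) y) ≤ v (algebraMap R (FractionRing R) x) := by
  have hne : ∀ x : R, x ≠ 0 → v (algebraMap R (FractionRing R) x) ≠ 0 := fun x hx => by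
    simpa using hx
  -- On nonzero elements the logarithm is nonpositive, so `toNat` loses nothing and a largest value
  -- is a least degree.
  let deg : R → ℕ := fun x => (-(WithZero.log (v (algebraMap R (FractionRing R) x)))).toNat
  obtain ⟨x, ⟨hxs, hx⟩, hmin⟩ :=
    exists_minimalFor_of_wellFoundedLT (fun x => x ∈ s ∧ x ≠ 0) deg hs
  refine ⟨x, hxs, fun y hy => ?_⟩
  by_cases hy0 : y = 0
  · simp [hy0]
  rw [← WithZero.log_le_log (hne y hy0) (hne x hx)]
  have hlog : ∀ z : R, z ≠ 0 → WithZero.log (v (algebraMap R (FractionRing R) z)) ≤ 0 := by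
    intro z hz
    simpa using (WithZero.log_le_log (hne z hz) one_ne_zero).2 (hv z)
  have h1 := hlog y hy0
  have h2 := hlog x hx
  have h3 : deg x ≤ deg y := by
    rcases le_total (deg x) (deg y) with h | h
    · exact h
    · exact hmin ⟨hy, hy0⟩ h
  simp only [deg] at h3
  omega

/-- Fix `a ≠ 0` in the first ideal. Each of the finitely many `v` with `v a ≠ 1` attains its maximum
over the union of the ideals at a finite stage. Past all these stages, `J m ⊆ cR` forces `v y ≤ v c`
for every later `y`; where `v a = 1`, the element `a` itself suffices. -/
theorem descendingChains_of_isKrullDomain (hR : IsKrullDomain R) :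
    DescendingChains (IntegralDivisor R) := by
  obtain ⟨S, -, hS, hfin⟩ := hR
  have hint : ∀ v ∈ S, ∀ x : R, v (algebraMap R (FractionRing R) x) ≤ 1 := fun v hv x =>
    (hS _).1 ⟨x, rfl⟩ v hv
  intro J hJ
  obtain ⟨a, haJ, ha⟩ := (J 0).exists_mem_ne_zero
  have hmono : ∀ {i j}, i ≤ j → (J i).ideal ≤ (J j).ideal := fun h => hJ h
  have hF := hfin (algebraMap R (FractionRing R) a) (by simpa using ha)
  have hmax : ∀ v ∈ {v ∈ S | v (algebraMap R (FractionRing R) a) ≠ 1}, ∃ n, ∃ x ∈ (J n).ideal,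
      ∀ i, ∀ y ∈ (J i).ideal,
        v (algebraMap R (FractionRing R) y) ≤ v (algebraMap R (FractionRing R) x) := by
    rintro v ⟨hv, -⟩
    obtain ⟨x, hx, hxmax⟩ := exists_forall_valuation_le (hint v hv)
      (s := ⋃ i, ((J i).ideal : Set R)) ⟨a, Set.mem_iUnion.2 ⟨0, haJ⟩, ha⟩
    obtain ⟨n, hn⟩ := Set.mem_iUnion.1 hx
    exact ⟨n, x, hn, fun i y hy => hxmax y (Set.mem_iUnion.2 ⟨i, hy⟩)⟩
  choose! n x hx hxmax using hmax
  obtain ⟨m, hm⟩ := (hF.image n).bddAbove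
  refine ⟨m, fun i hi => le_antisymm (hJ hi) fun y hy => ?_⟩
  rw [mem_ideal_iff]
  intro c hc
  have hc0 : c ≠ 0 := by
    rintro rfl
    obtain ⟨r, hr⟩ := mem_principalTrace.1 (hc (hmono (Nat.zero_le m) haJ))
    rw [smul_zero, eq_comm, map_eq_zero_iff _ (IsFractionRing.injective R (FractionRing R))] at hr
    exact ha hr
  have hbound : ∀ v ∈ S, ∀ z ∈ (J m).ideal, v (algebraMap R (FractionRing R) z) ≤ v c := by
    intro v hv z hz
    obtain ⟨r, hr⟩ := mem_principalTrace.1 (hc hz)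
    rw [← hr, Algebra.smul_def, map_mul]
    exact mul_le_of_le_one_left' (hint v hv r)
  have hdiv : algebraMap R (FractionRing R) y / c ∈ Set.range (algebraMap R (FractionRing R)) := by
    rw [hS]
    intro v hv
    rw [map_div₀]
    refine div_le_one_of_le₀ ?_ zero_le
    by_cases hva : v (algebraMap R (FractionRing R) a) = 1
    · exact (hint v hv y).trans (hva ▸ hbound v hv a (hmono (Nat.zero_le m) haJ))
    · have hvF : v ∈ {v ∈ S | v (algebraMap R (FractionRing R) a) ≠ 1} := ⟨hv, hva⟩
      exact (hxmax v hvF i y hy).trans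
        (hbound v hv _ (hmono (hm (Set.mem_image_of_mem n hvF)) (hx v hvF)))
  obtain ⟨r, hr⟩ := hdiv
  refine mem_principalTrace.2 ⟨r, ?_⟩
  rw [Algebra.smul_def, hr, div_mul_cancel₀ _ hc0]

/-! ### Valuations from the exponents of principal divisors -/

section Valuation

variable {ι : Type*} (φ : IntegralDivisor R ≃*o Multiplicative (ι →₀ ℕ))

/-- The exponent at `i` of the divisor of a nonzero element. -/
noncomputable def exponent (i : ι) (x : R) (hx : x ≠ 0) : ℕ :=
  Multiplicative.toAdd (φ (principal x hx)) i

theorem exponent_mul (i : ι) {x y : R} (hx : x ≠ 0) (hy : y ≠ 0) :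
    exponent φ i (x * y) (mul_ne_zero hx hy) = exponent φ i x hx + exponent φ i y hy := by
  simp [exponent, ← principal_mul_principal hx hy]

theorem exponent_one (i : ι) : exponent φ i (1 : R) one_ne_zero = 0 := by
  have : principal (1 : R) one_ne_zero = 1 := by
    ext1
    rw [principal_ideal, one_ideal, Ideal.span_singleton_one]
  simp [exponent, this]

theorem forall_exponent_le_iff {x y : R} (hx : x ≠ 0) (hy : y ≠ 0) :
    (∀ i, exponent φ i x hx ≤ exponent φ i y hy) ↔ x ∣ y := by
  rw [← principal_le_principal_iff (hx := hx) (hy := hy), ← map_le_map_iff φ]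
  exact Iff.rfl

theorem min_exponent_le_exponent_add (i : ι) {x y : R} (hx : x ≠ 0) (hy : y ≠ 0)
    (hxy : x + y ≠ 0) :
    min (exponent φ i x hx) (exponent φ i y hy) ≤ exponent φ i (x + y) hxy := by
  -- The divisor with exponents `f` has an ideal containing `x` and `y`, hence `x + y`.
  let f := Multiplicative.toAdd (φ (principal x hx)) ⊓ Multiplicative.toAdd (φ (principal y hy))
  have hle : ∀ J, φ.symm (Multiplicative.ofAdd f) ≤ J ↔ f ≤ Multiplicative.toAdd (φ J) := by
    intro J
    rw [← map_le_map_iff φ, OrderMonoidIso.apply_symm_apply]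
    rfl
  have h1 := le_principal_iff.1 ((hle (principal x hx)).2 inf_le_left)
  have h2 := le_principal_iff.1 ((hle (principal y hy)).2 inf_le_right)
  exact (hle _).1 (le_principal_iff.2 (Ideal.add_mem _ h1 h2) :
    _ ≤ principal (x + y) hxy) i

open Classical in
/-- The valuation on `R` given by the exponent at `i`. -/
noncomputable def exponentValuation (i : ι) : Valuation R (WithZero (Multiplicative ℤ)) where
  toFun x := if hx : x = 0 then 0 else WithZero.exp (-(exponent φ i x hx : ℤ))
  map_zero' := by simp
  map_one' := by simp [exponent_one]
  map_mul' x y := by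
    by_cases hx : x = 0
    · simp [hx]
    by_cases hy : y = 0
    · simp [hy]
    rw [dif_neg hx, dif_neg hy, dif_neg (mul_ne_zero hx hy), exponent_mul φ i hx hy,
      ← WithZero.exp_add]
    push_cast
    congr 1
    ring
  map_add_le_max' x y := by
    by_cases hx : x = 0
    · simp [hx]
    by_cases hy : y = 0
    · simp [hy]
    by_cases hxy : x + y = 0
    · simp [hxy]
    rw [dif_neg hx, dif_neg hy, dif_neg hxy, le_max_iff, WithZero.exp_le_exp, WithZero.exp_le_exp]
    have := min_exponent_le_exponent_add φ i hx hy hxy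
    omega

theorem exponentValuation_apply (i : ι) {x : R} (hx : x ≠ 0) :
    exponentValuation φ i x = WithZero.exp (-(exponent φ i x hx : ℤ)) :=
  dif_neg hx

theorem nonZeroDivisors_le_primeCompl_supp (i : ι) :
    nonZeroDivisors R ≤ (exponentValuation φ i).supp.primeCompl := by
  intro x hx
  rw [Ideal.mem_primeCompl_iff, Valuation.mem_supp_iff,
    exponentValuation_apply φ i (nonZeroDivisors.ne_zero hx)]
  exact WithZero.exp_ne_zero

/-- The extension of `exponentValuation` to the fraction field. -/
noncomputable def exponentValuationFractionRing (i : ι) :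
    Valuation (FractionRing R) (WithZero (Multiplicative ℤ)) :=
  (exponentValuation φ i).extendToLocalization (nonZeroDivisors_le_primeCompl_supp φ i)
    (FractionRing R)

theorem exponentValuationFractionRing_algebraMap (i : ι) {x : R} (hx : x ≠ 0) :
    exponentValuationFractionRing φ i (algebraMap R (FractionRing R) x) =
      WithZero.exp (-(exponent φ i x hx : ℤ)) := by
  rw [exponentValuationFractionRing, Valuation.extendToLocalization_apply_map_apply,
    exponentValuation_apply φ i hx]

theorem exponentValuationFractionRing_div (i : ι) {x y : R} (hx : x ≠ 0) (hy : y ≠ 0) :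
    exponentValuationFractionRing φ i
        (algebraMap R (FractionRing R) x / algebraMap R (FractionRing R) y) =
      WithZero.exp (exponent φ i y hy - exponent φ i x hx : ℤ) := by
  rw [map_div₀, exponentValuationFractionRing_algebraMap φ i hx,
    exponentValuationFractionRing_algebraMap φ i hy, ← WithZero.exp_sub]
  congr 1
  ring

/-- This makes the valuation surjective: any element of the `i`-th atom's ideal outside the ideal of
its square will do. -/
theorem exists_exponent_eq_one (i : ι) : ∃ (x : R) (hx : x ≠ 0), exponent φ i x hx = 1 := by
  have hle : ∀ f J, φ.symm (Multiplicative.ofAdd f) ≤ J ↔ f ≤ Multiplicative.toAdd (φ J) := by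
    intro f J
    rw [← map_le_map_iff φ, OrderMonoidIso.apply_symm_apply]
    rfl
  let e : ℕ → IntegralDivisor R := fun n => φ.symm (Multiplicative.ofAdd (Finsupp.single i n))
  have hlt : ¬ (e 1).ideal ≤ (e 2).ideal := by
    intro h
    have := (hle _ _).1 (show e 2 ≤ e 1 from h) i
    simp [e] at this
  obtain ⟨x, hx1, hx2⟩ := SetLike.not_le_iff_exists.1 hlt
  have hx : x ≠ 0 := by rintro rfl; exact hx2 (zero_mem _)
  have h1 := (hle _ _).1 ((le_principal_iff (hx := hx)).2 hx1)
  have h2 := mt (hle _ _).2 (mt (le_principal_iff (hx := hx)).1 hx2)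
  rw [Finsupp.single_le_iff] at h1 h2
  exact ⟨x, hx, by simp only [exponent]; omega⟩

theorem isKrullDomain_of_mulOrderIso
    (φ : IntegralDivisor R ≃*o Multiplicative (ι →₀ ℕ)) : IsKrullDomain R := by
  refine ⟨Set.range (exponentValuationFractionRing φ), ?_, fun z => ?_, fun z hz => ?_⟩
  · rintro _ ⟨i, rfl⟩ y
    by_cases hy : y = 0
    · exact ⟨0, by simp [hy]⟩
    obtain ⟨x, hx, h1⟩ := exists_exponent_eq_one φ i
    refine ⟨algebraMap R (FractionRing R) x ^ (-(WithZero.log y)), ?_⟩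
    rw [map_zpow₀, exponentValuationFractionRing_algebraMap φ i hx, h1, ← WithZero.exp_zsmul]
    simp [WithZero.exp_log hy]
  · obtain ⟨x, y, hy, rfl⟩ := IsFractionRing.div_surjective (A := R) z
    have hy0 := nonZeroDivisors.ne_zero hy
    have hy' : algebraMap R (FractionRing R) y ≠ 0 := by simpa using hy0
    by_cases hx : x = 0
    · simp [hx]
    rw [Set.forall_mem_range]
    have h1 : (∀ i, exponentValuationFractionRing φ i
        (algebraMap R (FractionRing R) x / algebraMap R (FractionRing R) y) ≤ 1) ↔ y ∣ x := by
      rw [← forall_exponent_le_iff φ hy0 hx]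
      refine forall_congr' fun i => ?_
      rw [exponentValuationFractionRing_div φ i hx hy0, ← WithZero.exp_zero, WithZero.exp_le_exp]
      omega
    rw [h1]
    constructor
    · rintro ⟨r, hr⟩
      rw [eq_div_iff hy', ← map_mul, (IsFractionRing.injective R (FractionRing R)).eq_iff] at hr
      exact ⟨r, by rw [← hr, mul_comm]⟩
    · rintro ⟨r, rfl⟩
      exact ⟨r, by rw [map_mul, mul_div_cancel_left₀ _ hy']⟩
  · obtain ⟨x, y, hy, rfl⟩ := IsFractionRing.div_surjective (A := R) z
    have hy0 := nonZeroDivisors.ne_zero hy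
    have hx : x ≠ 0 := by
      rintro rfl
      simp at hz
    classical
    -- A valuation nontrivial at `x / y` has its index in the support of the divisor of `x` or of
    -- `y`.
    refine (((Multiplicative.toAdd (φ (principal x hx))).support ∪
      (Multiplicative.toAdd (φ (principal y hy0))).support).finite_toSet.image
        (exponentValuationFractionRing φ)).subset ?_
    rintro _ ⟨⟨i, rfl⟩, hi⟩
    refine ⟨i, ?_, rfl⟩
    by_contra hmem
    simp only [Finset.coe_union, Set.mem_union, Finset.mem_coe, Finsupp.mem_support_iff,
      not_or, not_not] at hmem
    refine hi ?_
    rw [exponentValuationFractionRing_div φ i hx hy0, exponent, exponent, hmem.1, hmem.2]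
    simp

end Valuation

end IntegralDivisor

/-! ### The equivalences -/

theorem theorem3p1 (R : Type*) [CommRing R] [IsDomain R] :
    List.TFAE [
      IsKrullDomain R,
      ConditionD6 (IntegralDivisor R),
      DescendingChains (IntegralDivisor R) ∧
        ∀ J : IntegralDivisor R, JoinIrreducible J → J ∈ atomPowers (IntegralDivisor R),
      MulDistribJoin (IntegralDivisor R) ∧ CancellationLaw (IntegralDivisor R) ∧
        OrderDefinedByMul (IntegralDivisor R) ∧ DescendingChains (IntegralDivisor R),
      Nonempty (IntegralDivisor R ≃*o
        Multiplicative ({e : IntegralDivisor R // IsAtom e} →₀ ℕ))] := by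
  have h51 : Nonempty (IntegralDivisor R ≃*o
      Multiplicative ({e : IntegralDivisor R // IsAtom e} →₀ ℕ)) → IsKrullDomain R :=
    fun ⟨φ⟩ => IntegralDivisor.isKrullDomain_of_mulOrderIso φ
  tfae_have 5 → 1 := h51
  tfae_have 1 → 4 := fun h =>
    ⟨mulDistribJoin_of_cancel IntegralDivisor.bot_eq_one
        (IntegralDivisor.cancellationLaw_of_isKrullDomain h)
        (IntegralDivisor.orderDefinedByMul_of_isKrullDomain h),
      IntegralDivisor.cancellationLaw_of_isKrullDomain h,
      IntegralDivisor.orderDefinedByMul_of_isKrullDomain h,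
      IntegralDivisor.descendingChains_of_isKrullDomain h⟩
  tfae_have 4 → 5 := fun ⟨_, hcancel, hdvd, hdcc⟩ =>
    IntegralDivisor.nonempty_mulOrderIso_of_cancellationLaw hcancel hdvd hdcc
  tfae_have 5 → 2 := fun ⟨φ⟩ => conditionD6_of_mulOrderIso IntegralDivisor.bot_eq_one φ
  tfae_have 2 → 5 := IntegralDivisor.nonempty_mulOrderIso_of_conditionD6
  tfae_have 3 → 2 := fun ⟨hdcc, hirr⟩ => hdcc.conditionD6 hirr
  tfae_have 2 → 3 := fun h =>
    ⟨IntegralDivisor.descendingChains_of_isKrullDomain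
        (h51 (IntegralDivisor.nonempty_mulOrderIso_of_conditionD6 h)),
      fun _ hJ => h.mem_atomPowers hJ⟩
  tfae_finish
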